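/- Let $\mathcal{C}$ be a compactly generated triangulated category, that is, a triangulated category which has arbitrary (set-indexed) direct sums, such that every nonzero object $B$ of $\mathcal{C}$ admits a nonzero morphism $C\to B$ from a compact object $C$, and such that the isomorphism classes of compact objects form a set. Here an object $C$ is compact if every morphism $C\to\bigoplus_{i\in I}X_i$ factors through the canonical morphism $\bigoplus_{i\in F}X_i\to\bigoplus_{i\in I}X_i$ for some finite subset $F\subseteq I$. A nonzero object is called indecomposable if it is not isomorphic to a direct sum of two nonzero objects. Let $(A_i)_{i\in I}$ be a family of objects of $\mathcal{C}$, indexed by a set $I$, such that every endomorphism ring $\mathrm{End}(A_i)$ is local. Then: (a) If $B$ is an indecomposable direct summand of $\bigoplus_{i\in I}A_i$, then there exists $i\in I$ such that $B\cong A_i$. (b) If $(B_j)_{j\in J}$ is a family of indecomposable objects of $\mathcal{C}$, indexed by a set $J$, such that $\bigoplus_{i\in I}A_i\cong\bigoplus_{j\in J}B_j$, then there exists a bijection $\sigma:I\to J$ such that $A_i\cong B_{\sigma(i)}$ for every $i\in I$. -/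

import Mathlib

open CategoryTheory CategoryTheory.Limits

universe w v u

namespace KRSA

variable {C : Type u} [Category.{v} C]

/-- The canonical morphism `X(J) ⟶ X` from the partial direct sum indexed by a finite subset
`J ⊆ I` to the direct sum `X = ⨁_{i ∈ I} A i`. -/
noncomputable def partialSum [HasCoproducts.{w} C] {I : Type w} (A : I → C) (J : Finset I) :
    (∐ fun j : J => A j) ⟶ ∐ A :=
  Sigma.desc fun j : J => Sigma.ι A j

/-- An object `X` is compact if every morphism from `X` to a direct sum (indexed by a `w`-small
set) factors through a finite partial direct sum. -/
def IsCompactObject [HasCoproducts.{w} C] (X : C) : Prop :=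
  ∀ (I : Type w) (A : I → C) (f : X ⟶ ∐ A),
    ∃ (J : Finset I) (g : X ⟶ ∐ fun j : J => A j), g ≫ partialSum A J = f

/-- The property of objects of being compact. -/
def compactObjects (C : Type u) [Category.{v} C] [HasCoproducts.{w} C] : ObjectProperty C :=
  fun X => IsCompactObject.{w} X

/-- There are enough compact objects: every nonzero object receives a nonzero morphism from a
compact object. -/
def HasEnoughCompacts (C : Type u) [Category.{v} C] [HasZeroMorphisms C]
    [HasCoproducts.{w} C] : Prop :=
  ∀ B : C, ¬ IsZero B → ∃ (X : C) (f : X ⟶ B), IsCompactObject.{w} X ∧ f ≠ 0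

/-- For a (triangulated) category with direct sums, being compactly generated means that there are
enough compact objects and that the isomorphism classes of compact objects form a set. -/
structure IsCompactlyGenerated (C : Type u) [Category.{v} C] [HasZeroMorphisms C]
    [HasCoproducts.{w} C] : Prop where
  enough : HasEnoughCompacts.{w} C
  essentiallySmall : ObjectProperty.EssentiallySmall.{w} (compactObjects.{w} C)

/-- `B` is a direct summand of `X`: there is a decomposition `X ≅ B ⊕ B'`. -/
def IsDirectSummand [HasZeroMorphisms C] [HasBinaryBiproducts C] (B X : C) : Prop :=
  ∃ B' : C, Nonempty (X ≅ B ⊞ B')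

end KRSA

/-! A nonzero `x : K ⟶ X` with `K` compact reduces infinite sums to finite ones: `x ≫ u` has
finitely many components, and a morphism killing `x` is not invertible. For (a): if no `A i` were a
retract of `B`, subtracting from `𝟙 B` any finite sum of maps through the `A i` would leave an
automorphism (`isIso_one_sub_sum`), yet one such difference kills `x`. The retract `A i` splits off
`B` by the triangulated structure. For (b): by (a) each `End (B j)` is local. For fixed `X`, the
entries of `φ` and `φ⁻¹` at summands isomorphic to `X`, reduced to the residue division ring of `End
X`, form mutually inverse row-finite matrices (`exists_residue_coords`), so multiplicities agree by
invariance of dimension. -/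

namespace KRSA

/-! ### Residue division ring of a noncommutative local ring -/

section LocalRing

variable {R : Type*} [Ring R]

/-- A left inverse of an element of a local ring is also a right inverse. -/
theorem mul_eq_one_comm_of_isLocalRing [IsLocalRing R] {a b : R} (h : a * b = 1) :
    b * a = 1 := by
  have hid : b * a * (b * a) = b * a := by
    rw [mul_assoc, ← mul_assoc a b a, h, one_mul]
  -- The idempotent `b * a` or its complement is a unit, so `b * a` is `1` or `0`.
  rcases IsLocalRing.isUnit_or_isUnit_of_add_one (add_sub_cancel (b * a) 1) with hu | hu
  · exact hu.mul_left_cancel (by rw [hid, mul_one])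
  · have h0 : b * a = 0 := hu.mul_left_cancel (by rw [sub_mul, one_mul, hid, sub_self, mul_zero])
    have h1 : (1 : R) = 0 := by
      calc (1 : R) = a * (b * a) * b := by rw [mul_assoc, mul_assoc, h, mul_one, h]
        _ = 0 := by rw [h0, mul_zero, zero_mul]
    exact absurd h1 one_ne_zero

theorem isUnit_and_isUnit_of_isUnit_mul [IsLocalRing R] {a b : R} (h : IsUnit (a * b)) :
    IsUnit a ∧ IsUnit b := by
  obtain ⟨u, hu⟩ := h
  have hr : a * (b * ↑u⁻¹) = 1 := by rw [← mul_assoc, ← hu, Units.mul_inv]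
  have hl : (↑u⁻¹ * a) * b = 1 := by rw [mul_assoc, ← hu, Units.inv_mul]
  exact ⟨⟨⟨a, _, hr, mul_eq_one_comm_of_isLocalRing hr⟩, rfl⟩,
    ⟨⟨b, _, mul_eq_one_comm_of_isLocalRing hl, hl⟩, rfl⟩⟩

/-- The ideal of nonunits of a local ring which is not assumed to be commutative. -/
def nonunitsIdeal (R : Type*) [Ring R] [IsLocalRing R] : Ideal R where
  __ := IsLocalRing.nonunitsAddSubmonoid R
  smul_mem' _ _ hx h := hx (isUnit_and_isUnit_of_isUnit_mul h).2

theorem mem_nonunitsIdeal [IsLocalRing R] {a : R} : a ∈ nonunitsIdeal R ↔ ¬ IsUnit a := Iff.rfl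

instance [IsLocalRing R] : (nonunitsIdeal R).IsTwoSided where
  mul_mem_of_left _ hx h := hx (isUnit_and_isUnit_of_isUnit_mul h).1

instance [IsLocalRing R] : Nontrivial (R ⧸ nonunitsIdeal R) :=
  Ideal.Quotient.nontrivial_iff.2 fun h =>
    mem_nonunitsIdeal.1 (h ▸ Submodule.mem_top : (1 : R) ∈ nonunitsIdeal R) isUnit_one

/-- The residue division ring of a local ring which is not assumed to be commutative. -/
noncomputable instance [IsLocalRing R] : DivisionRing (R ⧸ nonunitsIdeal R) :=
  DivisionRing.ofIsUnitOrEqZero fun a => by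
    obtain ⟨a, rfl⟩ := Ideal.Quotient.mk_surjective a
    by_cases ha : IsUnit a
    · exact Or.inl (ha.map _)
    · exact Or.inr (Ideal.Quotient.eq_zero_iff_mem.2 ha)

end LocalRing

/-! ### Local endomorphism rings and quasi-regularity -/

section Preadditive

variable {C : Type u} [Category.{v} C] [Preadditive C]

/-- The residue map of a local endomorphism ring, written multiplicatively in diagrammatic
order. -/
theorem exists_residue (X : C) [IsLocalRing (End X)] :
    ∃ (D : Type v) (_ : DivisionRing D) (ρ : (X ⟶ X) →+ D), ρ (𝟙 X) = 1 ∧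
      (∀ f g, ρ (f ≫ g) = ρ f * ρ g) ∧ ∀ f, ρ f = 0 ↔ ¬ IsIso f := by
  let q := Ideal.Quotient.mk (nonunitsIdeal (End X))
  -- The opposite ring appears because `f * g` in `End X` is `g ≫ f`.
  refine ⟨(End X ⧸ nonunitsIdeal (End X))ᵐᵒᵖ, inferInstance,
    { toFun := fun f => MulOpposite.op (q f)
      map_zero' := ?_
      map_add' := fun f g => ?_ }, ?_, fun f g => ?_, fun f => ?_⟩
  · exact congrArg MulOpposite.op (map_zero q)
  · exact congrArg MulOpposite.op (map_add q f g)
  · exact congrArg MulOpposite.op (map_one q)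
  · exact congrArg MulOpposite.op (q.map_mul (End.of g) (End.of f))
  · rw [← isUnit_iff_isIso, ← mem_nonunitsIdeal, ← Ideal.Quotient.eq_zero_iff_mem]
    exact MulOpposite.op_eq_zero_iff (q f)

theorem isIso_or_isIso_one_sub {X : C} [IsLocalRing (End X)] (f : X ⟶ X) :
    IsIso f ∨ IsIso (𝟙 X - f) := by
  rw [← isUnit_iff_isIso, ← isUnit_iff_isIso]
  exact IsLocalRing.isUnit_or_isUnit_of_add_one (R := End X) (add_sub_cancel f (𝟙 X))

theorem not_isZero_of_isLocalRing (X : C) [IsLocalRing (End X)] : ¬ IsZero X := fun h =>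
  one_ne_zero (α := End X) (h.eq_of_src _ _)

theorem isLocalRing_end_of_iso {X Y : C} (e : X ≅ Y) [IsLocalRing (End X)] :
    IsLocalRing (End Y) := by
  have : Nontrivial (End Y) := ⟨1, 0, fun h =>
    not_isZero_of_isLocalRing X (((IsZero.iff_id_eq_zero Y).2 h).of_iso e)⟩
  refine IsLocalRing.of_isUnit_or_isUnit_one_sub_self fun f => ?_
  rw [isUnit_iff_isIso, isUnit_iff_isIso]
  have conj : ∀ g : Y ⟶ Y, IsIso (e.hom ≫ g ≫ e.inv) → IsIso g := fun g _ => by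
    have : g = e.inv ≫ (e.hom ≫ g ≫ e.inv) ≫ e.hom := by simp
    rw [this]
    infer_instance
  refine (isIso_or_isIso_one_sub (e.hom ≫ f ≫ e.inv)).imp (conj f) fun h => conj (𝟙 Y - End.asHom f) ?_
  simpa [Preadditive.sub_comp, Preadditive.comp_sub] using h

/-- A retract of an object with local endomorphism ring which itself has a local endomorphism ring
is isomorphic to it. -/
theorem nonempty_iso_of_isIso_comp {X Y : C} [IsLocalRing (End X)] [IsLocalRing (End Y)]
    (a : X ⟶ Y) (b : Y ⟶ X) (h : IsIso (a ≫ b)) : Nonempty (X ≅ Y) := by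
  let c : Y ⟶ X := b ≫ inv (a ≫ b)
  have hac : a ≫ c = 𝟙 X := by rw [← Category.assoc, IsIso.hom_inv_id]
  have hid : (c ≫ a) ≫ (c ≫ a) = c ≫ a := by
    rw [Category.assoc, reassoc_of% hac]
  rcases isIso_or_isIso_one_sub (c ≫ a) with hu | hu
  · exact ⟨⟨a, c, hac, by rw [← cancel_epi (c ≫ a), hid, Category.comp_id]⟩⟩
  · have h0 : c ≫ a = 0 := by
      rw [← cancel_epi (𝟙 Y - c ≫ a), Preadditive.sub_comp, hid, Category.id_comp, sub_self,
        comp_zero]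
    refine absurd ?_ (one_ne_zero (α := End X))
    calc 𝟙 X = a ≫ (c ≫ a) ≫ c := by rw [Category.assoc, hac, Category.comp_id, hac]
      _ = 0 := by rw [h0, zero_comp, comp_zero]

/-- If `𝟙 - b ≫ a` is invertible, then so is `𝟙 - a ≫ b`. -/
theorem isIso_one_sub_comp_swap {X Y : C} (a : X ⟶ Y) (b : Y ⟶ X) (h : IsIso (𝟙 Y - b ≫ a)) :
    IsIso (𝟙 X - a ≫ b) := by
  obtain ⟨c, hc, hc'⟩ := h
  rw [Preadditive.sub_comp, Category.id_comp, Category.assoc, sub_eq_iff_eq_add] at hc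
  rw [Preadditive.comp_sub, Category.comp_id, sub_eq_iff_eq_add] at hc'
  -- The witness is suggested by the geometric series `1 + ab + abab + ...`, with `c` standing for
  -- `(1 - ba)⁻¹`.
  refine ⟨𝟙 X + a ≫ c ≫ b, ?_, ?_⟩
  · have : a ≫ b ≫ a ≫ c ≫ b = a ≫ c ≫ b - a ≫ b := by
      have := congrArg (fun t => a ≫ t ≫ b) hc
      simp only [Preadditive.comp_add, Preadditive.add_comp, Category.id_comp,
        Category.assoc] at this
      exact eq_sub_of_add_eq' this.symm
    simp only [Preadditive.sub_comp, Preadditive.comp_add, Category.id_comp, Category.comp_id,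
      Category.assoc, this]
    abel
  · have : a ≫ c ≫ b ≫ a ≫ b = a ≫ c ≫ b - a ≫ b := by
      have := congrArg (fun t => a ≫ t ≫ b) hc'
      simp only [Preadditive.comp_add, Preadditive.add_comp, Category.id_comp,
        Category.assoc] at this
      exact eq_sub_of_add_eq' this.symm
    simp only [Preadditive.comp_sub, Preadditive.add_comp, Category.id_comp, Category.comp_id,
      Category.assoc, this]
    abel

/-- Endomorphisms of `B` which factor through finitely many objects with local endomorphism rings,
none of which is a retract of `B`, are quasi-regular. -/
theorem isIso_one_sub_sum {I : Type*} (A : I → C) [∀ i, IsLocalRing (End (A i))] {B : C}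
    (h : ∀ i (a : A i ⟶ B) (b : B ⟶ A i), ¬ IsIso (a ≫ b))
    (a : ∀ i, A i ⟶ B) (b : ∀ i, B ⟶ A i) (F : Finset I) :
    IsIso (𝟙 B - ∑ i ∈ F, b i ≫ a i) := by
  classical
  induction F using Finset.induction_on with
  | empty => rw [Finset.sum_empty, sub_zero]; infer_instance
  | insert k F hk ih =>
    rw [Finset.sum_insert hk]
    set s := 𝟙 B - ∑ i ∈ F, b i ≫ a i with hs
    -- Factoring out the automorphism `s` leaves a single term, which the swap lemma moves to the
    -- local ring `End (A k)`.
    have heq : 𝟙 B - (b k ≫ a k + ∑ i ∈ F, b i ≫ a i) =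
        (𝟙 B - b k ≫ a k ≫ inv s) ≫ s := by
      rw [Preadditive.sub_comp, Category.id_comp, Category.assoc, Category.assoc,
        IsIso.inv_hom_id, Category.comp_id, hs]
      abel
    have hu : IsIso (𝟙 (A k) - (a k ≫ inv s) ≫ b k) :=
      (isIso_or_isIso_one_sub _).resolve_left (h k _ _)
    have := isIso_one_sub_comp_swap _ _ hu
    rw [heq]
    infer_instance

end Preadditive

/-! ### Compactness and multiplicities of summands -/

section Coproducts

variable {C : Type u} [Category.{v} C] [Preadditive C] [HasCoproducts.{w} C]

open Classical in
/-- A morphism from a compact object to a direct sum is the sum of finitely many components. -/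
theorem IsCompactObject.exists_eq_sum {X : C} (hX : IsCompactObject.{w} X) {I : Type w}
    (A : I → C) (f : X ⟶ ∐ A) :
    ∃ F : Finset I, (∀ i ∉ F, f ≫ Sigma.π A i = 0) ∧
      f = ∑ i ∈ F, f ≫ Sigma.π A i ≫ Sigma.ι A i := by
  obtain ⟨F, g, rfl⟩ := hX I A f
  refine ⟨F, fun i hi => ?_, ?_⟩
  · have : partialSum A F ≫ Sigma.π A i = 0 := Sigma.hom_ext _ _ fun j => by
      simpa [partialSum] using Sigma.ι_π_of_ne A (b := j.1) (c := i) (fun h => hi (h ▸ j.2))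
    rw [Category.assoc, this, comp_zero]
  · have : partialSum A F = ∑ i ∈ F, partialSum A F ≫ Sigma.π A i ≫ Sigma.ι A i :=
      Sigma.hom_ext _ _ fun j => by
        rw [Preadditive.comp_sum, Finset.sum_eq_single (j : I)]
        · simp [partialSum]
        · intro i _ hi
          simp [partialSum, Sigma.ι_π_of_ne_assoc A hi.symm]
        · exact fun h => absurd j.2 h
    conv_lhs => rw [this]
    simp only [Preadditive.comp_sum, Category.assoc]

/-- A nonzero retract `B` of a direct sum of objects with local endomorphism rings has one of these
objects as a retract. -/
theorem exists_isIso_comp_of_retract (hC : HasEnoughCompacts.{w} C) {I : Type w} (A : I → C)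
    [∀ i, IsLocalRing (End (A i))] {B : C} (hB : ¬ IsZero B) (r : Retract B (∐ A)) :
    ∃ (i : I) (a : A i ⟶ B) (b : B ⟶ A i), IsIso (a ≫ b) := by
  classical
  by_contra! h
  obtain ⟨X, x, hX, hx⟩ := hC B hB
  obtain ⟨F, -, hF⟩ := hX.exists_eq_sum A (x ≫ r.i)
  have := isIso_one_sub_sum A h (fun i => Sigma.ι A i ≫ r.r) (fun i => r.i ≫ Sigma.π A i) F
  apply hx
  rw [← cancel_mono (𝟙 B - ∑ i ∈ F, (r.i ≫ Sigma.π A i) ≫ Sigma.ι A i ≫ r.r), zero_comp,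
    Preadditive.comp_sub, Category.comp_id, sub_eq_zero]
  calc x = (x ≫ r.i) ≫ r.r := by rw [Category.assoc, r.retract, Category.comp_id]
    _ = _ := by
      rw [hF]
      simp only [Preadditive.comp_sum, Preadditive.sum_comp, Category.assoc]

open Classical in
/-- The residue of a composition `X ⟶ ∐ B ⟶ X` is computed by the components at those `B j` which
are isomorphic to `X`, finitely many of which contribute. -/
theorem exists_residue_coords (hC : HasEnoughCompacts.{w} C) {X : C} (hX : ¬ IsZero X)
    {D : Type*} [Ring D] (ρ : (X ⟶ X) →+ D) (hmul : ∀ f g, ρ (f ≫ g) = ρ f * ρ g)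
    (hρ : ∀ f, ¬ IsIso f → ρ f = 0) {J : Type w} (B : J → C) {p : J → Prop}
    (β : ∀ j : {j // p j}, X ≅ B j)
    (hp : ∀ j, ¬ p j → ∀ (a : X ⟶ B j) (b : B j ⟶ X), ¬ IsIso (a ≫ b)) (u : X ⟶ ∐ B) :
    ∃ c : {j // p j} →₀ D, (∀ j, c j = ρ (u ≫ Sigma.π B j ≫ (β j).inv)) ∧
      ∀ v : ∐ B ⟶ X, ρ (u ≫ v) = c.sum fun j d => d * ρ ((β j).hom ≫ Sigma.ι B j ≫ v) := by
  obtain ⟨K, x, hK, hx⟩ := hC X hX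
  have key : ∀ f, x ≫ f = 0 → ρ f = 0 := fun f hf => hρ f fun _ =>
    hx (by rw [← cancel_mono f, hf, zero_comp])
  -- Outside `F` the components of `u` are killed by `x`, so their residues vanish.
  obtain ⟨F, hF0, hF⟩ := hK.exists_eq_sum B (x ≫ u)
  refine ⟨Finsupp.onFinset (F.subtype p) (fun j => ρ (u ≫ Sigma.π B j ≫ (β j).inv)) ?_,
    fun j => rfl, fun v => ?_⟩
  · intro j hj
    by_contra hjF
    refine hj (key _ ?_)
    have := hF0 j fun h => hjF (Finset.mem_subtype.2 h)
    rw [Category.assoc] at this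
    rw [reassoc_of% this, zero_comp]
  · rw [Finsupp.onFinset_sum _ (fun j => zero_mul _)]
    have h1 : ρ (u ≫ v) = ∑ j ∈ F, ρ (u ≫ Sigma.π B j ≫ Sigma.ι B j ≫ v) := by
      rw [← map_sum, ← sub_eq_zero, ← map_sub]
      apply key
      rw [Preadditive.comp_sub, sub_eq_zero, ← Category.assoc, hF]
      simp only [Preadditive.comp_sum, Preadditive.sum_comp, Category.assoc]
    rw [h1, ← Finset.sum_filter_of_ne (p := p), ← Finset.sum_subtype_eq_sum_filter]
    · refine Finset.sum_congr rfl fun j _ => ?_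
      rw [← hmul]
      simp
    · intro j _ hj
      by_contra hpj
      refine hj (hρ _ ?_)
      simpa only [Category.assoc] using hp j hpj (u ≫ Sigma.π B j) (Sigma.ι B j ≫ v)

/-- In two decompositions of an object, the summands isomorphic to a given object `X` with local
endomorphism ring are in bijection. -/
theorem nonempty_equiv_summands (hC : HasEnoughCompacts.{w} C) (X : C) [IsLocalRing (End X)]
    {I J : Type w} (A : I → C) (B : J → C) {p : I → Prop} {q : J → Prop}
    (α : ∀ i : {i // p i}, X ≅ A i) (β : ∀ j : {j // q j}, X ≅ B j)
    (hp : ∀ i, ¬ p i → ∀ (a : X ⟶ A i) (b : A i ⟶ X), ¬ IsIso (a ≫ b))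
    (hq : ∀ j, ¬ q j → ∀ (a : X ⟶ B j) (b : B j ⟶ X), ¬ IsIso (a ≫ b))
    (φ : ∐ A ≅ ∐ B) : Nonempty ({i // p i} ≃ {j // q j}) := by
  classical
  obtain ⟨D, _, ρ, hone, hmul, hρ⟩ := exists_residue X
  have hX := not_isZero_of_isLocalRing X
  have coordsA := exists_residue_coords hC hX ρ hmul (fun f => (hρ f).2) A α hp
  have coordsB := exists_residue_coords hC hX ρ hmul (fun f => (hρ f).2) B β hq
  choose cA hcA hsumA using coordsA
  choose cB hcB hsumB using coordsB
  let M : ({i // p i} →₀ D) →ₗ[D] ({j // q j} →₀ D) :=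
    Finsupp.linearCombination D fun i => cB ((α i).hom ≫ Sigma.ι A i ≫ φ.hom)
  let N : ({j // q j} →₀ D) →ₗ[D] ({i // p i} →₀ D) :=
    Finsupp.linearCombination D fun j => cA ((β j).hom ≫ Sigma.ι B j ≫ φ.inv)
  have hMN : N ∘ₗ M = LinearMap.id := by
    -- The `(i, i')` entry is the residue of the component of `φ.hom ≫ φ.inv` from `A i` to `A i'`.
    refine Finsupp.lhom_ext' fun i => LinearMap.ext_ring (Finsupp.ext fun i' => ?_)
    have := hsumB ((α i).hom ≫ Sigma.ι A i ≫ φ.hom) (φ.inv ≫ Sigma.π A i' ≫ (α i').inv)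
    simp only [Category.assoc, Iso.hom_inv_id_assoc] at this
    simp only [LinearMap.comp_apply, Finsupp.lsingle_apply, LinearMap.id_apply, M, N,
      Finsupp.linearCombination_single, one_smul]
    rw [Finsupp.linearCombination_apply, Finsupp.sum_apply]
    simp only [Finsupp.smul_apply, smul_eq_mul, hcA, Category.assoc]
    rw [← this]
    by_cases h : i = i'
    · subst h
      simp [hone]
    · rw [Sigma.ι_π_of_ne_assoc A (fun h' => h (Subtype.ext h'))]
      simp [Finsupp.single_eq_of_ne (Ne.symm h)]
  have hNM : M ∘ₗ N = LinearMap.id := by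
    refine Finsupp.lhom_ext' fun j => LinearMap.ext_ring (Finsupp.ext fun j' => ?_)
    have := hsumA ((β j).hom ≫ Sigma.ι B j ≫ φ.inv) (φ.hom ≫ Sigma.π B j' ≫ (β j').inv)
    simp only [Category.assoc, Iso.inv_hom_id_assoc] at this
    simp only [LinearMap.comp_apply, Finsupp.lsingle_apply, LinearMap.id_apply, M, N,
      Finsupp.linearCombination_single, one_smul]
    rw [Finsupp.linearCombination_apply, Finsupp.sum_apply]
    simp only [Finsupp.smul_apply, smul_eq_mul, hcB, Category.assoc]
    rw [← this]
    by_cases h : j = j'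
    · subst h
      simp [hone]
    · rw [Sigma.ι_π_of_ne_assoc B (fun h' => h (Subtype.ext h'))]
      simp [Finsupp.single_eq_of_ne (Ne.symm h)]
  exact ⟨Module.Basis.indexEquiv Finsupp.basisSingleOne
    ((Finsupp.basisSingleOne (R := D)).map (LinearEquiv.ofLinearMap M N hNM hMN).symm)⟩

end Coproducts

/-! ### Splitting off retracts by distinguished triangles -/

section Triangulated

variable {C : Type u} [Category.{v} C] [Preadditive C] [HasZeroObject C] [HasShift C ℤ]
  [∀ n : ℤ, (shiftFunctor C n).Additive] [Pretriangulated C]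

open Pretriangulated in
/-- A nonzero retract of an indecomposable object of a pretriangulated category is isomorphic to
it. -/
theorem nonempty_iso_of_indecomposable {B X : C} (hB : Indecomposable B) (hX : ¬ IsZero X)
    (a : X ⟶ B) (b : B ⟶ X) (h : IsIso (a ≫ b)) : Nonempty (B ≅ X) := by
  obtain ⟨Z, g, δ, hT⟩ := distinguished_cocone_triangle a
  -- `a` is a split monomorphism, hence so is its shift, which `δ` composes with to zero.
  have hδ : δ = 0 := by
    have h0 : δ ≫ a⟦(1 : ℤ)⟧' = 0 := comp_distTriang_mor_zero₃₁ _ hT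
    rw [← cancel_mono ((a ≫ b)⟦(1 : ℤ)⟧'), Functor.map_comp, reassoc_of% h0, zero_comp, zero_comp]
  obtain ⟨e, -, -⟩ := exists_iso_binaryBiproduct_of_distTriang _ hT hδ
  have hZ : IsZero Z := (hB.2 X Z e).resolve_left hX
  have := (Biprod.isIso_inl_iff_isZero X Z).2 hZ
  exact ⟨e ≪≫ (asIso (biprod.inl : X ⟶ X ⊞ Z)).symm⟩

/-- An indecomposable retract of a direct sum of objects with local endomorphism rings is isomorphic
to one of them. -/
theorem exists_iso_of_retract [HasCoproducts.{w} C] (hC : HasEnoughCompacts.{w} C) {I : Type w}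
    (A : I → C) [∀ i, IsLocalRing (End (A i))] {B : C} (hB : Indecomposable B)
    (r : Retract B (∐ A)) : ∃ i, Nonempty (B ≅ A i) := by
  obtain ⟨i, a, b, h⟩ := exists_isIso_comp_of_retract hC A hB.1 r
  exact ⟨i, nonempty_iso_of_indecomposable hB (not_isZero_of_isLocalRing _) a b h⟩

end Triangulated

/-- Two decompositions of an object into summands with local endomorphism rings agree up to
permutation and isomorphism of the summands. -/
theorem exists_equiv_of_iso {C : Type u} [Category.{v} C] [Preadditive C] [HasCoproducts.{w} C]
    (hC : HasEnoughCompacts.{w} C) {I J : Type w} (A : I → C) (B : J → C)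
    [∀ i, IsLocalRing (End (A i))] [∀ j, IsLocalRing (End (B j))] (φ : ∐ A ≅ ∐ B) :
    ∃ σ : I ≃ J, ∀ i, Nonempty (A i ≅ B (σ i)) := by
  let cl : C → Quotient (isIsomorphicSetoid C) := Quotient.mk _
  have hcl : ∀ X (c : Quotient (isIsomorphicSetoid C)), cl X = c ↔ Nonempty (c.out ≅ X) :=
    fun X c => Quotient.mk_eq_iff_out.trans ⟨fun ⟨e⟩ => ⟨e.symm⟩, fun ⟨e⟩ => ⟨e.symm⟩⟩
  have fiber : ∀ c, Nonempty ({i // cl (A i) = c} ≃ {j // cl (B j) = c}) := by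
    intro c
    by_cases hloc : IsLocalRing (End c.out)
    · exact nonempty_equiv_summands hC c.out A B
        (fun i => ((hcl _ _).1 i.2).some) (fun j => ((hcl _ _).1 j.2).some)
        (fun i hi a b h => hi ((hcl _ _).2 (nonempty_iso_of_isIso_comp a b h)))
        (fun j hj a b h => hj ((hcl _ _).2 (nonempty_iso_of_isIso_comp a b h))) φ
    · have : IsEmpty {i // cl (A i) = c} := ⟨fun i => hloc
        (isLocalRing_end_of_iso ((hcl _ _).1 i.2).some.symm)⟩
      have : IsEmpty {j // cl (B j) = c} := ⟨fun j => hloc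
        (isLocalRing_end_of_iso ((hcl _ _).1 j.2).some.symm)⟩
      exact ⟨Equiv.equivOfIsEmpty _ _⟩
  -- The bijections over each isomorphism class are glued together.
  refine ⟨Equiv.ofFiberEquiv fun c => (fiber c).some, fun i => ?_⟩
  exact Quotient.exact (Equiv.ofFiberEquiv_map (fun c => (fiber c).some) i).symm

end KRSA

theorem corollary4p2 {C : Type u} [Category.{v} C] [Preadditive C] [HasZeroObject C]
    [HasShift C ℤ] [∀ n : ℤ, (shiftFunctor C n).Additive] [Pretriangulated C] [IsTriangulated C]
    [HasCoproducts.{w} C] (hC : KRSA.IsCompactlyGenerated.{w} C)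
    {I : Type w} (A : I → C) (hA : ∀ i, IsLocalRing (End (A i))) :
    (∀ B : C, Indecomposable B → KRSA.IsDirectSummand B (∐ A) →
      ∃ i, Nonempty (B ≅ A i)) ∧
    (∀ (J : Type w) (B : J → C), (∀ j, Indecomposable (B j)) → Nonempty ((∐ A) ≅ ∐ B) →
      ∃ σ : I ≃ J, ∀ i, Nonempty (A i ≅ B (σ i))) := by
  classical
  refine ⟨fun B hB ⟨B', ⟨e⟩⟩ => KRSA.exists_iso_of_retract hC.enough A hB
    { i := biprod.inl ≫ e.inv, r := e.hom ≫ biprod.fst }, fun J B hB ⟨φ⟩ => ?_⟩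
  have : ∀ j, IsLocalRing (End (B j)) := fun j => by
    obtain ⟨i, ⟨e⟩⟩ := KRSA.exists_iso_of_retract hC.enough A (hB j)
      { i := Sigma.ι B j ≫ φ.inv, r := φ.hom ≫ Sigma.π B j }
    exact KRSA.isLocalRing_end_of_iso e.symm
  exact KRSA.exists_equiv_of_iso hC.enough A B φ
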